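/- Throughout, manifolds are smooth, real and finite-dimensional. Let $G$ be a real Lie group, let $\pi:P\to X$ be a smooth principal $G$-bundle (with $G$ acting on $P$ on the right), and let $H$ be a closed subgroup of $G$. A reduced principal $H$-subbundle of $P$ is a subset $Q\subseteq P$ which, with the restricted projection, the restricted action of $H$ and the smooth structure induced from $P$, is a smooth principal $H$-bundle over $X$. An isomorphism over $X$ of two such subbundles is an $H$-equivariant diffeomorphism between them that covers $\mathrm{id}_X$. A vertical principal automorphism of $P$ is a $G$-equivariant diffeomorphism $\Phi:P\to P$ with $\pi\circ\Phi=\pi$. Suppose that the structure group $G$ of $P$ is reducible to $H$, that is, $P$ has a reduced principal $H$-subbundle. (1) If $\Phi$ is a vertical principal automorphism of $P$ and $P^h\subseteq P$ is a reduced principal $H$-subbundle, then $\Phi(P^h)$ is a reduced principal $H$-subbundle of $P$, and $\Phi|_{P^h}:P^h\to\Phi(P^h)$ is an isomorphism over $X$ of principal $H$-bundles. (2) Conversely, if $P^h,P^{h'}\subseteq P$ are reduced principal $H$-subbundles and $\varphi:P^h\to P^{h'}$ is an isomorphism over $X$ of principal $H$-bundles, then there is a vertical principal automorphism $\Phi$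 of $P$ with $\Phi|_{P^h}=\varphi$. -/

import Mathlib

open scoped Manifold ContDiff RightActions

/-- A map `f : A → N` from a subset `A` of a manifold `M` to a manifold `N` is smooth if near every
point of `A` it is the restriction of a smooth map defined on an open subset of `M`.  If `A` is an
embedded submanifold, these are exactly the smooth maps for its induced manifold structure; this
applies in particular to closed subgroups of a Lie group. -/
def SmoothOnSubset {E M F N : Type*}
    [NormedAddCommGroup E] [NormedSpace ℝ E] {HM : Type*} [TopologicalSpace HM]
    (I : ModelWithCorners ℝ E HM) [TopologicalSpace M] [ChartedSpace HM M]
    [NormedAddCommGroup F] [NormedSpace ℝ F] {HN : Type*} [TopologicalSpace HN]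
    (J : ModelWithCorners ℝ F HN) [TopologicalSpace N] [ChartedSpace HN N]
    (A : Set M) (f : A → N) : Prop :=
  ∀ a : A, ∃ W : Set M, IsOpen W ∧ (a : M) ∈ W ∧
    ∃ g : M → N, ContMDiffOn I J ∞ g W ∧ ∀ b : A, (b : M) ∈ W → g b = f b

/-- A diffeomorphism between a subset `A` of a manifold `M` and a subset `B` of a manifold `N`. -/
structure SubsetDiffeo {E M F N : Type*}
    [NormedAddCommGroup E] [NormedSpace ℝ E] {HM : Type*} [TopologicalSpace HM]
    (I : ModelWithCorners ℝ E HM) [TopologicalSpace M] [ChartedSpace HM M]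
    [NormedAddCommGroup F] [NormedSpace ℝ F] {HN : Type*} [TopologicalSpace HN]
    (J : ModelWithCorners ℝ F HN) [TopologicalSpace N] [ChartedSpace HN N]
    (A : Set M) (B : Set N) extends A ≃ B where
  smooth_toFun : SmoothOnSubset I J A (fun a => (toFun a : N))
  smooth_invFun : SmoothOnSubset J I B (fun b => (invFun b : M))

section PrincipalBundles

variable {EX EP EG : Type*}
  [NormedAddCommGroup EX] [NormedSpace ℝ EX]
  [NormedAddCommGroup EP] [NormedSpace ℝ EP]
  [NormedAddCommGroup EG] [NormedSpace ℝ EG]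
  {X P G : Type*}
  [TopologicalSpace X] [ChartedSpace EX X]
  [TopologicalSpace P] [ChartedSpace EP P]
  [TopologicalSpace G] [ChartedSpace EG G] [Group G] [MulAction Gᵐᵒᵖ P]

variable (EX EP EG) in
/-- A smooth local trivialization over `U ⊆ X` of a subset `Q ⊆ P` as a principal `H`-bundle: an
`H`-equivariant diffeomorphism from the part of `Q` over `U` to `U × H` that covers the identity
of `U`.  Here `p <• g` is the right action of `g` on `p`. -/
structure PrincipalTrivialization (π : P → X) (H : Subgroup G) (Q : Set P) (U : Set X) extends
    SubsetDiffeo 𝓘(ℝ, EP) (𝓘(ℝ, EX).prod 𝓘(ℝ, EG)) (Q ∩ π ⁻¹' U) (U ×ˢ (H : Set G)) where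
  fst_toFun : ∀ p : ↥(Q ∩ π ⁻¹' U), (toFun p : X × G).1 = π p
  snd_toFun_act : ∀ (p : ↥(Q ∩ π ⁻¹' U)) (h : H)
    (hp : (p : P) <• (h : G) ∈ Q ∩ π ⁻¹' U),
    (toFun ⟨(p : P) <• (h : G), hp⟩ : X × G).2 = (toFun p : X × G).2 * (h : G)

variable (EX EP EG) in
/-- `Q ⊆ P`, with the restrictions of the projection `π : P → X` and of the right action, is a
smooth principal bundle over `X` with structure group `H`: the group `H` preserves `Q` and acts
freely and transitively on the fibres of `Q → X`, and `Q → X` is locally trivial. -/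
structure IsPrincipalSubbundle (π : P → X) (H : Subgroup G) (Q : Set P) : Prop where
  act_mem : ∀ p ∈ Q, ∀ h ∈ H, p <• h ∈ Q
  proj_act : ∀ p ∈ Q, ∀ h ∈ H, π (p <• h) = π p
  existsUnique_act : ∀ p ∈ Q, ∀ q ∈ Q, π p = π q → ∃! h : H, p <• (h : G) = q
  locally_trivial : ∀ x : X, ∃ U : Set X, IsOpen U ∧ x ∈ U ∧
    Nonempty (PrincipalTrivialization EX EP EG π H Q U)

variable (EX EP EG) in
/-- `π : P → X` is a smooth principal `G`-bundle. -/
structure IsPrincipalBundle (π : P → X) : Prop where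
  smooth_proj : ContMDiff 𝓘(ℝ, EP) 𝓘(ℝ, EX) ∞ π
  smooth_act : ContMDiff (𝓘(ℝ, EP).prod 𝓘(ℝ, EG)) 𝓘(ℝ, EP) ∞ (fun a : P × G => a.1 <• a.2)
  principal : IsPrincipalSubbundle EX EP EG π (⊤ : Subgroup G) (Set.univ : Set P)

variable (EX EP EG) in
/-- The structure group of `π : P → X` is reducible to `H`: there is a reduced principal
`H`-subbundle. -/
def IsReducibleTo (π : P → X) (H : Subgroup G) : Prop :=
  ∃ Q : Set P, IsPrincipalSubbundle EX EP EG π H Q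

variable (EP) in
/-- An isomorphism over `X` of the reduced principal `H`-subbundles `Q` and `Q'` of `P`. -/
structure PrincipalSubbundleIso (π : P → X) (H : Subgroup G) (Q Q' : Set P) extends
    SubsetDiffeo 𝓘(ℝ, EP) 𝓘(ℝ, EP) Q Q' where
  proj_toFun : ∀ q : Q, π (toFun q) = π q
  toFun_act : ∀ (q : Q) (h : H) (hq : (q : P) <• (h : G) ∈ Q),
    (toFun ⟨(q : P) <• (h : G), hq⟩ : P) = (toFun q : P) <• (h : G)

variable (EP G) in
/-- A vertical principal automorphism of `π : P → X`: a `G`-equivariant diffeomorphism of `P` over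
the identity of `X`. -/
structure VerticalPrincipalAut (π : P → X) extends Diffeomorph 𝓘(ℝ, EP) 𝓘(ℝ, EP) P P ∞ where
  proj_toFun : ∀ p : P, π (toFun p) = π p
  toFun_act : ∀ (p : P) (g : G), toFun (p <• g) = toFun p <• g

end PrincipalBundles

/-! Part (1) is transport of structure along `Φ`: trivializations of `Q` precomposed with `Φ⁻¹`
trivialize the image. For part (2), each point of `P` is `q <• g` with `q ∈ Q`, the pair being
unique up to `(q <• h, h⁻¹ * g)` with `h ∈ H`. So `Φ (q <• g) = φ q <• g` is forced, and
`H`-equivariance makes it well defined. It is smooth because a local section `s` of `Q` gives `p = s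
(π p) <• τ p` with `τ` smooth (`exists_smooth_division`), hence `Φ p = φ (s (π p)) <• τ p` near any
point (`exists_equivariant_extension`). Extending `φ⁻¹` in the same way gives the inverse of `Φ`. -/

section SmoothSubsets

variable {E F K M N L : Type*}
  [NormedAddCommGroup E] [NormedSpace ℝ E] {HM : Type*} [TopologicalSpace HM]
  {I : ModelWithCorners ℝ E HM} [TopologicalSpace M] [ChartedSpace HM M]
  [NormedAddCommGroup F] [NormedSpace ℝ F] {HN : Type*} [TopologicalSpace HN]
  {J : ModelWithCorners ℝ F HN} [TopologicalSpace N] [ChartedSpace HN N]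
  [NormedAddCommGroup K] [NormedSpace ℝ K] {HL : Type*} [TopologicalSpace HL]
  {J' : ModelWithCorners ℝ K HL} [TopologicalSpace L] [ChartedSpace HL L]

/-! ### Smooth maps on subsets -/

/-- The restriction of a smooth map is smooth. -/
theorem ContMDiff.smoothOnSubset {g : M → N} (hg : ContMDiff I J ∞ g) (A : Set M) :
    SmoothOnSubset I J A (fun a => g a) :=
  fun _ => ⟨Set.univ, isOpen_univ, trivial, g, hg.contMDiffOn, fun _ _ => rfl⟩

theorem SmoothOnSubset.comp {A : Set M} {B : Set N} {f : A → N} {k : B → L}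
    (hk : SmoothOnSubset J J' B k) (hf : SmoothOnSubset I J A f) (h : ∀ a, f a ∈ B) :
    SmoothOnSubset I J' A (fun a => k ⟨f a, h a⟩) := by
  intro a
  obtain ⟨W, hW, haW, g, hg, hgf⟩ := hf a
  obtain ⟨V, hV, haV, l, hl, hlk⟩ := hk ⟨f a, h a⟩
  refine ⟨W ∩ g ⁻¹' V, hg.continuousOn.isOpen_inter_preimage hW hV, ⟨haW, ?_⟩, l ∘ g,
    hl.comp (hg.mono Set.inter_subset_left) fun _ hx => hx.2, ?_⟩
  · rw [Set.mem_preimage, hgf a haW]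
    exact haV
  · rintro b ⟨hbW, hbV⟩
    rw [Set.mem_preimage, hgf b hbW] at hbV
    rw [Function.comp_apply, hgf b hbW]
    exact hlk ⟨f b, h b⟩ hbV

/-- A smooth map on a subset is, near each point, the restriction of a map smooth at that point. -/
theorem SmoothOnSubset.exists_contMDiffAt {A : Set M} {f : A → N} (hf : SmoothOnSubset I J A f)
    (a : A) : ∃ g : M → N, ContMDiffAt I J ∞ g a ∧
      ∀ᶠ b in nhds (a : M), ∀ hb : b ∈ A, g b = f ⟨b, hb⟩ := by
  obtain ⟨W, hW, haW, g, hg, hgf⟩ := hf a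
  refine ⟨g, hg.contMDiffAt (hW.mem_nhds haW), ?_⟩
  filter_upwards [hW.mem_nhds haW] with b hb hbA using hgf ⟨b, hbA⟩ hb

/-- The inverse of a diffeomorphism of subsets. -/
def SubsetDiffeo.symm {A : Set M} {B : Set N} (e : SubsetDiffeo I J A B) :
    SubsetDiffeo J I B A where
  toEquiv := e.toEquiv.symm
  smooth_toFun := e.smooth_invFun
  smooth_invFun := e.smooth_toFun

/-- The composite of diffeomorphisms of subsets. -/
def SubsetDiffeo.trans {A : Set M} {B : Set N} {C : Set L} (e : SubsetDiffeo I J A B)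
    (e' : SubsetDiffeo J J' B C) : SubsetDiffeo I J' A C where
  toEquiv := e.toEquiv.trans e'.toEquiv
  smooth_toFun := e'.smooth_toFun.comp e.smooth_toFun fun a => (e.toFun a).2
  smooth_invFun := e.smooth_invFun.comp e'.smooth_invFun fun c => (e'.invFun c).2

/-- A diffeomorphism restricts to a diffeomorphism of subsets that correspond to each other. -/
def Diffeomorph.toSubsetDiffeo (Φ : Diffeomorph I J M N ∞) {A : Set M} {B : Set N}
    (h : ∀ a, a ∈ A ↔ Φ a ∈ B) : SubsetDiffeo I J A B where
  toEquiv := Φ.toEquiv.subtypeEquiv h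
  smooth_toFun := Φ.contMDiff_toFun.smoothOnSubset A
  smooth_invFun := Φ.contMDiff_invFun.smoothOnSubset B

end SmoothSubsets

theorem act_act {P G : Type*} [Group G] [MulAction Gᵐᵒᵖ P] (p : P) (g h : G) :
    (p <• g) <• h = p <• (g * h) := by
  rw [MulOpposite.op_mul, mul_smul]

section PrincipalSubbundles

variable {EX EP EG : Type*}
  [NormedAddCommGroup EX] [NormedSpace ℝ EX]
  [NormedAddCommGroup EP] [NormedSpace ℝ EP]
  [NormedAddCommGroup EG] [NormedSpace ℝ EG]
  {X P G : Type*}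
  [TopologicalSpace X] [ChartedSpace EX X]
  [TopologicalSpace P] [ChartedSpace EP P]
  [TopologicalSpace G] [ChartedSpace EG G] [Group G] [MulAction Gᵐᵒᵖ P]
  {π : P → X} {H : Subgroup G} {Q Q' : Set P}

/-! ### Transport of subbundles and inverse isomorphisms -/

theorem VerticalPrincipalAut.mem_image_iff (Φ : VerticalPrincipalAut EP G π) (p : P) :
    Φ.toFun p ∈ Φ.toFun '' Q ↔ p ∈ Q :=
  Φ.toEquiv.injective.mem_set_image

/-- A vertical principal automorphism carries local trivializations of `Q` to local
trivializations of its image. -/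
noncomputable def PrincipalTrivialization.image {U : Set X} (t : PrincipalTrivialization EX EP EG π H Q U)
    (Φ : VerticalPrincipalAut EP G π) :
    PrincipalTrivialization EX EP EG π H (Φ.toFun '' Q) U where
  toSubsetDiffeo := (Φ.toDiffeomorph.toSubsetDiffeo (A := Q ∩ π ⁻¹' U)
    (B := Φ.toFun '' Q ∩ π ⁻¹' U) fun p =>
      and_congr (Φ.mem_image_iff p).symm
        (by rw [Set.mem_preimage, Set.mem_preimage]; exact (Φ.proj_toFun p).symm ▸ Iff.rfl)).symm.trans
      t.toSubsetDiffeo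
  fst_toFun p := by
    refine (t.fst_toFun _).trans ?_
    have h := Φ.proj_toFun (Φ.invFun p)
    rw [Φ.right_inv] at h
    exact h.symm
  snd_toFun_act p h hp := by
    -- Equivariance passes to `Φ⁻¹` by injectivity of `Φ`.
    have key : Φ.invFun ((p : P) <• (h : G)) = Φ.invFun p <• (h : G) := by
      apply Φ.toEquiv.injective
      exact (Φ.right_inv _).trans
        ((Φ.toFun_act _ _).trans (congrArg (· <• (h : G)) (Φ.right_inv _))).symm
    have hmem : Φ.invFun p <• (h : G) ∈ Q ∩ π ⁻¹' U := by
      rw [← key]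
      refine ⟨(Φ.mem_image_iff _).1 ?_, ?_⟩
      · rw [Φ.right_inv]; exact hp.1
      · rw [Set.mem_preimage, ← Φ.proj_toFun, Φ.right_inv]; exact hp.2
    have hpm : Φ.invFun (p : P) ∈ Q ∩ π ⁻¹' U := by
      refine ⟨(Φ.mem_image_iff _).1 ?_, ?_⟩
      · rw [Φ.right_inv]; exact p.2.1
      · rw [Set.mem_preimage, ← Φ.proj_toFun, Φ.right_inv]; exact p.2.2
    refine Eq.trans ?_ (t.snd_toFun_act ⟨Φ.invFun p, hpm⟩ h hmem)
    exact congrArg (fun q => (t.toFun q : X × G).2) (Subtype.ext key)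

theorem IsPrincipalSubbundle.image (hQ : IsPrincipalSubbundle EX EP EG π H Q)
    (Φ : VerticalPrincipalAut EP G π) :
    IsPrincipalSubbundle EX EP EG π H (Φ.toFun '' Q) where
  act_mem := by
    rintro _ ⟨p, hp, rfl⟩ h hh
    exact ⟨p <• h, hQ.act_mem p hp h hh, Φ.toFun_act p h⟩
  proj_act := by
    rintro _ ⟨p, hp, rfl⟩ h hh
    rw [← Φ.toFun_act, Φ.proj_toFun, Φ.proj_toFun, hQ.proj_act p hp h hh]
  existsUnique_act := by
    rintro _ ⟨p, hp, rfl⟩ _ ⟨q, hq, rfl⟩ hpq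
    rw [Φ.proj_toFun, Φ.proj_toFun] at hpq
    -- The same `h` carries `p` to `q` and `Φ p` to `Φ q`.
    refine (existsUnique_congr fun h => ?_).1 (hQ.existsUnique_act p hp q hq hpq)
    rw [← Φ.toFun_act]
    exact Φ.toEquiv.injective.eq_iff.symm
  locally_trivial x := by
    obtain ⟨U, hU, hx, ⟨t⟩⟩ := hQ.locally_trivial x
    exact ⟨U, hU, hx, ⟨t.image Φ⟩⟩

/-- The restriction of a vertical principal automorphism to a reduced subbundle. -/
noncomputable def VerticalPrincipalAut.restrict (Φ : VerticalPrincipalAut EP G π) (H : Subgroup G) (Q : Set P) :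
    PrincipalSubbundleIso EP π H Q (Φ.toFun '' Q) where
  toSubsetDiffeo := Φ.toDiffeomorph.toSubsetDiffeo fun p => (Φ.mem_image_iff p).symm
  proj_toFun q := Φ.proj_toFun q
  toFun_act q h _ := Φ.toFun_act q h

/-- The inverse of an isomorphism of reduced subbundles. -/
noncomputable def PrincipalSubbundleIso.symm (hQ : IsPrincipalSubbundle EX EP EG π H Q)
    (φ : PrincipalSubbundleIso EP π H Q Q') : PrincipalSubbundleIso EP π H Q' Q where
  toSubsetDiffeo := φ.toSubsetDiffeo.symm
  proj_toFun q := by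
    have h := φ.proj_toFun (φ.invFun q)
    rw [φ.right_inv] at h
    exact h.symm
  toFun_act q h hq := by
    have hm : (φ.invFun q : P) <• (h : G) ∈ Q := hQ.act_mem _ (φ.invFun q).2 h h.2
    have key : φ.toFun ⟨(φ.invFun q : P) <• (h : G), hm⟩ = ⟨(q : P) <• (h : G), hq⟩ := by
      apply Subtype.ext
      rw [φ.toFun_act, φ.right_inv]
    have := φ.left_inv ⟨(φ.invFun q : P) <• (h : G), hm⟩
    rw [key] at this
    exact congrArg Subtype.val this

/-! ### Local sections and smooth division -/

/-- A principal subbundle has smooth local sections. -/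
theorem IsPrincipalSubbundle.exists_local_section
    (hQ : IsPrincipalSubbundle EX EP EG π H Q) (x : X) :
    ∃ s : X → P, ContMDiffAt 𝓘(ℝ, EX) 𝓘(ℝ, EP) ∞ s x ∧
      ∀ᶠ y in nhds x, s y ∈ Q ∧ π (s y) = y := by
  obtain ⟨U, hU, hx, ⟨t⟩⟩ := hQ.locally_trivial x
  obtain ⟨g, hg, hgt⟩ := t.smooth_invFun.exists_contMDiffAt ⟨(x, 1), hx, H.one_mem⟩
  have hι : ContMDiffAt 𝓘(ℝ, EX) (𝓘(ℝ, EX).prod 𝓘(ℝ, EG)) ∞ (fun y : X => (y, (1 : G))) x :=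
    contMDiffAt_id.prodMk contMDiffAt_const
  -- The unit section of the trivialization, through the ambient extension `g` of its inverse.
  refine ⟨fun y => g (y, 1), ContMDiffAt.comp x hg hι, ?_⟩
  filter_upwards [hι.continuousAt.eventually hgt, hU.mem_nhds hx] with y hy hyU
  have hm : (y, (1 : G)) ∈ U ×ˢ (H : Set G) := ⟨hyU, H.one_mem⟩
  rw [hy hm]
  refine ⟨(t.invFun ⟨_, hm⟩).2.1, ?_⟩
  rw [← t.fst_toFun, t.right_inv]

theorem IsPrincipalSubbundle.exists_mem_fiber
    (hQ : IsPrincipalSubbundle EX EP EG π H Q) (x : X) : ∃ q ∈ Q, π q = x := by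
  obtain ⟨s, -, hs⟩ := hQ.exists_local_section x
  exact ⟨s x, hs.self_of_nhds⟩

theorem IsPrincipalBundle.proj_act (hP : IsPrincipalBundle EX EP EG (G := G) π) (p : P) (g : G) :
    π (p <• g) = π p :=
  hP.principal.proj_act p trivial g trivial

theorem IsPrincipalBundle.act_injective (hP : IsPrincipalBundle EX EP EG (G := G) π) (p : P) :
    Function.Injective fun g : G => p <• g := by
  intro g h hgh
  have := (hP.principal.existsUnique_act p trivial (p <• h) trivial (hP.proj_act p h).symm).unique
    (y₁ := ⟨g, trivial⟩) (y₂ := ⟨h, trivial⟩) hgh rfl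
  exact congrArg Subtype.val this

theorem IsPrincipalBundle.exists_act_eq (hP : IsPrincipalBundle EX EP EG (G := G) π) {p q : P}
    (h : π p = π q) : ∃ g : G, p <• g = q := by
  obtain ⟨g, hg, -⟩ := hP.principal.existsUnique_act p trivial q trivial h
  exact ⟨g, hg⟩

/-- Every point of `P` is a translate of a point of a reduced subbundle. -/
theorem IsPrincipalBundle.exists_mem_act_eq
    (hP : IsPrincipalBundle EX EP EG (G := G) π) (hQ : IsPrincipalSubbundle EX EP EG π H Q)
    (p : P) : ∃ (q : Q) (g : G), (q : P) <• g = p := by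
  obtain ⟨q, hq, hqp⟩ := hQ.exists_mem_fiber (π p)
  obtain ⟨g, hg⟩ := hP.exists_act_eq hqp
  exact ⟨⟨q, hq⟩, g, hg⟩

/-- Near each point, a smooth map `σ` into the fibres of `P` differs from the identity by a smooth
`G`-valued function. -/
theorem IsPrincipalBundle.exists_smooth_division [LieGroup 𝓘(ℝ, EG) ∞ G]
    (hP : IsPrincipalBundle EX EP EG (G := G) π) {σ : P → P} {p : P}
    (hσ : ContMDiffAt 𝓘(ℝ, EP) 𝓘(ℝ, EP) ∞ σ p) (hπ : ∀ᶠ q in nhds p, π (σ q) = π q) :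
    ∃ τ : P → G, ContMDiffAt 𝓘(ℝ, EP) 𝓘(ℝ, EG) ∞ τ p ∧ ∀ᶠ q in nhds p, σ q <• τ q = q := by
  obtain ⟨U, hU, hx, ⟨t⟩⟩ := hP.principal.locally_trivial (π p)
  have hσp : σ p ∈ Set.univ ∩ π ⁻¹' U := ⟨trivial, by
    rw [Set.mem_preimage, hπ.self_of_nhds]; exact hx⟩
  obtain ⟨k, hk, hkt⟩ := t.smooth_toFun.exists_contMDiffAt ⟨p, trivial, hx⟩
  obtain ⟨l, hl, hlt⟩ := t.smooth_toFun.exists_contMDiffAt ⟨σ p, hσp⟩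
  have hlσ : ContMDiffAt 𝓘(ℝ, EP) (𝓘(ℝ, EX).prod 𝓘(ℝ, EG)) ∞ (fun q => l (σ q)) p :=
    ContMDiffAt.comp p hl hσ
  -- If `σ q <• g = q`, the group coordinates satisfy `(k q).2 = (l (σ q)).2 * g`; solve for `g`.
  refine ⟨fun q => (l (σ q)).2⁻¹ * (k q).2,
    (contMDiffAt_snd.comp p hlσ).inv.mul (contMDiffAt_snd.comp p hk), ?_⟩
  filter_upwards [hkt, hσ.continuousAt.eventually hlt, hπ,
    (hU.preimage hP.smooth_proj.continuous).mem_nhds hx] with q hkq hlq hπq hqU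
  have hq : q ∈ Set.univ ∩ π ⁻¹' U := ⟨trivial, hqU⟩
  have hσq : σ q ∈ Set.univ ∩ π ⁻¹' U := ⟨trivial, by rw [Set.mem_preimage, hπq]; exact hqU⟩
  obtain ⟨g, hg⟩ := hP.exists_act_eq hπq
  have hact := t.snd_toFun_act ⟨σ q, hσq⟩ ⟨g, trivial⟩ (by rw [hg]; exact hq)
  simp only [hg] at hact
  rw [hkq hq, hlq hσq]
  refine Eq.trans ?_ hg
  rw [hact, inv_mul_cancel_left]

/-! ### Equivariant extension -/

/-- A smooth `H`-equivariant map over `X` from a reduced subbundle to `P` extends to a smooth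
`G`-equivariant map of `P`. -/
theorem IsPrincipalBundle.exists_equivariant_extension [LieGroup 𝓘(ℝ, EG) ∞ G]
    (hP : IsPrincipalBundle EX EP EG (G := G) π) (hQ : IsPrincipalSubbundle EX EP EG π H Q)
    (f : Q → P) (hf : SmoothOnSubset 𝓘(ℝ, EP) 𝓘(ℝ, EP) Q f)
    (hact : ∀ (q : Q) (h : H) (hq : (q : P) <• (h : G) ∈ Q),
      f ⟨(q : P) <• (h : G), hq⟩ = f q <• (h : G)) :
    ∃ F : P → P, ContMDiff 𝓘(ℝ, EP) 𝓘(ℝ, EP) ∞ F ∧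
      ∀ (q : Q) (g : G), F ((q : P) <• g) = f q <• g := by
  -- An arbitrary choice of decompositions, with no regularity; `hF` shows that the value does not
  -- depend on it.
  choose r γ hr using hP.exists_mem_act_eq hQ
  have hF : ∀ (q : Q) (g : G), f (r ((q : P) <• g)) <• γ ((q : P) <• g) = f q <• g := by
    intro q g
    have hrq := hr ((q : P) <• g)
    obtain ⟨r', hr'⟩ : ∃ r', r' = r ((q : P) <• g) := ⟨_, rfl⟩
    obtain ⟨g', hg'⟩ : ∃ g', g' = γ ((q : P) <• g) := ⟨_, rfl⟩
    rw [← hr', ← hg'] at hrq ⊢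
    have hπ : π q = π r' := by rw [← hP.proj_act q g, ← hrq, hP.proj_act]
    obtain ⟨h, hh, -⟩ := hQ.existsUnique_act q q.2 r' r'.2 hπ
    have hm : (q : P) <• (h : G) ∈ Q := hQ.act_mem q q.2 h h.2
    have hrr : r' = ⟨(q : P) <• (h : G), hm⟩ := Subtype.ext hh.symm
    -- Freeness of the `G`-action ties the two group elements together.
    have hg : (h : G) * g' = g := by
      apply hP.act_injective q
      simp only
      rw [← act_act, hh, hrq]
    rw [hrr, hact, act_act, hg]
  refine ⟨fun p => f (r p) <• γ p, fun p => ?_, hF⟩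
  -- Near `p` the arbitrary choice can now be replaced by the smooth decomposition `s (π q) <• τ q =
  -- q`.
  obtain ⟨s, hs, hsQ⟩ := hQ.exists_local_section (π p)
  have hπ := hP.smooth_proj.contMDiffAt (x := p)
  have hσ : ContMDiffAt 𝓘(ℝ, EP) 𝓘(ℝ, EP) ∞ (fun q => s (π q)) p := ContMDiffAt.comp p hs hπ
  have hσQ := hπ.continuousAt.eventually hsQ
  obtain ⟨τ, hτ, hτσ⟩ := hP.exists_smooth_division hσ (hσQ.mono fun _ h => h.2)
  obtain ⟨k, hk, hkf⟩ := hf.exists_contMDiffAt ⟨s (π p), hσQ.self_of_nhds.1⟩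
  have hkσ : ContMDiffAt 𝓘(ℝ, EP) 𝓘(ℝ, EP) ∞ (fun q => k (s (π q))) p :=
    ContMDiffAt.comp p hk hσ
  refine ContMDiffAt.congr_of_eventuallyEq
    (ContMDiffAt.comp p hP.smooth_act.contMDiffAt (hkσ.prodMk hτ)) ?_
  filter_upwards [hσQ, hτσ, hσ.continuousAt.eventually hkf] with q hq hτq hkq
  have h := hF ⟨s (π q), hq.1⟩ (τ q)
  simp only [hτq] at h
  rw [h, Function.comp_apply, hkq hq.1]

/-- An isomorphism of reduced subbundles extends to a vertical principal automorphism. -/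
theorem PrincipalSubbundleIso.exists_extension [LieGroup 𝓘(ℝ, EG) ∞ G]
    (hP : IsPrincipalBundle EX EP EG (G := G) π) (hQ : IsPrincipalSubbundle EX EP EG π H Q)
    (hQ' : IsPrincipalSubbundle EX EP EG π H Q') (φ : PrincipalSubbundleIso EP π H Q Q') :
    ∃ Φ : VerticalPrincipalAut EP G π, ∀ q : Q, Φ.toFun q = (φ.toFun q : P) := by
  obtain ⟨F, hF, hFφ⟩ := hP.exists_equivariant_extension hQ _ φ.smooth_toFun φ.toFun_act
  obtain ⟨F', hF', hFφ'⟩ := hP.exists_equivariant_extension hQ' _ φ.smooth_invFun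
    (φ.symm hQ).toFun_act
  refine ⟨⟨⟨⟨F, F', fun p => ?_, fun p => ?_⟩, hF, hF'⟩, fun p => ?_, fun p g => ?_⟩, fun q => ?_⟩
  · obtain ⟨q, g, rfl⟩ := hP.exists_mem_act_eq hQ p
    rw [hFφ, hFφ', φ.left_inv]
  · obtain ⟨q, g, rfl⟩ := hP.exists_mem_act_eq hQ' p
    rw [hFφ', hFφ, φ.right_inv]
  · obtain ⟨q, g, rfl⟩ := hP.exists_mem_act_eq hQ p
    change π (F _) = _
    rw [hFφ, hP.proj_act, hP.proj_act, φ.proj_toFun]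
  · obtain ⟨q, h, rfl⟩ := hP.exists_mem_act_eq hQ p
    change F _ = F _ <• g
    rw [act_act, hFφ, hFφ, act_act]
  -- On `Q` itself, take `g = 1`.
  · have h := hFφ q 1
    rw [MulOpposite.op_one, one_smul, one_smul] at h
    exact h

end PrincipalSubbundles

theorem mainTheorem10
    {EX EP EG X P G : Type*}
    [NormedAddCommGroup EX] [NormedSpace ℝ EX] [FiniteDimensional ℝ EX]
    [NormedAddCommGroup EP] [NormedSpace ℝ EP] [FiniteDimensional ℝ EP]
    [NormedAddCommGroup EG] [NormedSpace ℝ EG] [FiniteDimensional ℝ EG]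
    [TopologicalSpace X] [ChartedSpace EX X] [IsManifold 𝓘(ℝ, EX) ∞ X]
    [TopologicalSpace P] [ChartedSpace EP P] [IsManifold 𝓘(ℝ, EP) ∞ P]
    [TopologicalSpace G] [ChartedSpace EG G] [Group G] [LieGroup 𝓘(ℝ, EG) ∞ G]
    [MulAction Gᵐᵒᵖ P]
    (π : P → X) (hP : IsPrincipalBundle EX EP EG (G := G) π)
    (H : Subgroup G) (hH : IsClosed (H : Set G))
    (hred : IsReducibleTo EX EP EG π H) :
    (∀ (Φ : VerticalPrincipalAut EP G π) (Q : Set P), IsPrincipalSubbundle EX EP EG π H Q →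
      IsPrincipalSubbundle EX EP EG π H (Φ.toFun '' Q) ∧
      ∃ φ : PrincipalSubbundleIso EP π H Q (Φ.toFun '' Q),
        ∀ q : Q, (φ.toFun q : P) = Φ.toFun q) ∧
    (∀ Q Q' : Set P, IsPrincipalSubbundle EX EP EG π H Q →
      IsPrincipalSubbundle EX EP EG π H Q' →
      ∀ φ : PrincipalSubbundleIso EP π H Q Q',
        ∃ Φ : VerticalPrincipalAut EP G π, ∀ q : Q, Φ.toFun q = (φ.toFun q : P)) :=
  ⟨fun Φ Q hQ => ⟨hQ.image Φ, Φ.restrict H Q, fun _ => rfl⟩,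
    fun _ _ hQ hQ' φ => φ.exists_extension hP hQ hQ'⟩
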